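/- Let $G=(V,E)$ be a graph and $C$ a set of colours. For a colouring $\omega:V\to C$ (not necessarily proper), a move $(v,d)$ with $v\in V$, $d\in C$ gives colour $d$ to all vertices in the monochromatic component of $v$, that is, to all vertices joined to $v$ by a path in $G$ all of whose vertices have the same colour as $v$. Let $m(G,\omega,d)$ be the minimum number of moves, starting from $\omega$, after which every vertex of $G$ has colour $d$, and let $m(G,\omega)=\min_{d\in C}m(G,\omega,d)$. For a positive integer $c$ define $$M_c(G)=\max_{\omega} m(G,\omega),$$ where the maximum is over all surjective colourings $\omega:V\to\{1,\ldots,c\}$ and the moves use colours from $\{1,\ldots,c\}$. **Theorem.** Let $n\ge 3$, let $1\le c\le n$, and let $G$ be a cycle on $n$ vertices. Then $$M_c(G)=n-\left\lceil \frac{n}{c}\right\rceil .$$ -/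

import Mathlib

namespace FloodIt

variable {V C : Type*}

/-- The spanning subgraph of `G` whose edges join vertices of equal colour. Its connected components
are the monochromatic components of `G` under `ω`. -/
def monoGraph (G : SimpleGraph V) (ω : V → C) : SimpleGraph V where
  Adj u v := G.Adj u v ∧ ω u = ω v
  symm := ⟨fun _ _ h => ⟨h.1.symm, h.2.symm⟩⟩
  loopless := ⟨fun _ h => G.irrefl h.1⟩

open Classical in
/-- The colouring after the move `m = (v, d)`: colour `d` is given to the whole monochromatic
component of `v`. -/
noncomputable def move (G : SimpleGraph V) (ω : V → C) (m : V × C) : V → C :=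
  fun u => if (monoGraph G ω).Reachable m.1 u then m.2 else ω u

/-- The colouring after a sequence of moves, played from left to right. -/
noncomputable def play (G : SimpleGraph V) (ω : V → C) (S : List (V × C)) : V → C :=
  S.foldl (move G) ω

/-- `m(G, ω, d)`: the minimum number of moves that give every vertex colour `d`
(`⊤` if no sequence of moves does so). -/
noncomputable def minMovesTo (G : SimpleGraph V) (ω : V → C) (d : C) : ℕ∞ :=
  ⨅ S : {S : List (V × C) // ∀ v, play G ω S v = d}, (S.1.length : ℕ∞)

/-- `m(G, ω)`: the minimum number of moves that make `G` monochromatic. -/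
noncomputable def minMoves (G : SimpleGraph V) (ω : V → C) : ℕ∞ :=
  ⨅ d : C, minMovesTo G ω d

/-- `M_c(G)`: the maximum of `m(G, ω)` over all surjective colourings `ω` of the vertices with
`c` colours. -/
noncomputable def maxMoves (G : SimpleGraph V) (c : ℕ) : ℕ∞ :=
  ⨆ ω : {ω : V → Fin c // Function.Surjective ω}, minMoves G ω.1

end FloodIt

namespace FloodIt

section General

variable {V C : Type*}

/-! Upper bound (`minMoves_le`): some colour already occupies at least `⌈n / c⌉` vertices, and the
others can be recoloured one by one. Lower bound: take the colouring with period `c`. Reading a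
winning play backwards, each move adds one block to a noncrossing partition into monochromatic
blocks, because the recoloured component is an arc (`exists_noncrossing_of_play`). Blocks then lie
in residue classes mod `c`, and noncrossing forces at least `n - ⌊(n - 1) / c⌋` of them
(`card_image_noncrossing`). So `k + 1` is at least this number, where `⌊(n - 1) / c⌋ + 1 = ⌈n / c⌉`.
-/

theorem move_of_reachable {G : SimpleGraph V} {ω : V → C} {m : V × C} {u : V}
    (h : (monoGraph G ω).Reachable m.1 u) : move G ω m u = m.2 := by
  simp [move, h]

theorem move_of_not_reachable {G : SimpleGraph V} {ω : V → C} {m : V × C} {u : V}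
    (h : ¬ (monoGraph G ω).Reachable m.1 u) : move G ω m u = ω u := by
  simp [move, h]

/-- A property that is invariant along the edges of a graph between vertices reachable from `v`
is constant on the vertices reachable from `v`. -/
theorem iff_of_reachable {G : SimpleGraph V} {v w : V} (S : V → Prop)
    (hS : ∀ x y, G.Reachable v x → G.Reachable v y → G.Adj x y → (S x ↔ S y))
    (h : G.Reachable v w) : S v ↔ S w := by
  have h' := (SimpleGraph.reachable_iff_reflTransGen v w).1 h
  induction h' with
  | refl => exact Iff.rfl
  | @tail x y hx hxy ih =>
    have hx' : G.Reachable v x := (SimpleGraph.reachable_iff_reflTransGen v x).2 hx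
    exact (ih hx').trans (hS x y hx' h hxy)

theorem color_eq_of_reachable {G : SimpleGraph V} {ω : V → C} {v w : V}
    (h : (monoGraph G ω).Reachable v w) : ω w = ω v :=
  (iff_of_reachable (fun x => ω x = ω v)
    (fun x y _ _ hxy => by rw [show ω x = ω y from hxy.2]) h).1 rfl

open Classical in
/-- All vertices can be given colour `d` by recolouring the vertices of other colours in turn. -/
theorem exists_play_le_card_ne [Fintype V] (G : SimpleGraph V) (d : C) (k : ℕ) :
    ∀ ω : V → C, (Finset.univ.filter fun v => ω v ≠ d).card ≤ k →
      ∃ S : List (V × C), S.length ≤ k ∧ ∀ v, play G ω S v = d := by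
  induction k with
  | zero =>
    intro ω h
    refine ⟨[], le_rfl, fun v => ?_⟩
    have h0 := Finset.card_eq_zero.1 (Nat.le_zero.1 h)
    by_contra hv
    exact Finset.notMem_empty v (h0 ▸ Finset.mem_filter.2 ⟨Finset.mem_univ v, hv⟩)
  | succ k ih =>
    intro ω h
    by_cases hω : ∀ v, ω v = d
    · exact ⟨[], Nat.zero_le _, hω⟩
    · push Not at hω
      obtain ⟨v, hv⟩ := hω
      have hlt : (Finset.univ.filter fun u => move G ω (v, d) u ≠ d) ⊂
          Finset.univ.filter fun u => ω u ≠ d := by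
        refine (Finset.ssubset_iff_of_subset fun u hu => ?_).2 ⟨v, by simpa using hv, ?_⟩
        · simp only [Finset.mem_filter, Finset.mem_univ, true_and] at hu ⊢
          by_cases hr : (monoGraph G ω).Reachable v u
          · exact absurd (move_of_reachable (m := (v, d)) hr) hu
          · rwa [move_of_not_reachable (m := (v, d)) hr] at hu
        · simp [move_of_reachable (m := (v, d)) (SimpleGraph.Reachable.refl v)]
      obtain ⟨S, hS, hS'⟩ := ih (move G ω (v, d))
        (Nat.le_of_lt_succ ((Finset.card_lt_card hlt).trans_le h))
      exact ⟨(v, d) :: S, by simpa using hS, hS'⟩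

theorem minMoves_le_of_play {G : SimpleGraph V} {ω : V → C} {d : C} {S : List (V × C)} {k : ℕ}
    (hS : ∀ v, play G ω S v = d) (hk : S.length ≤ k) : minMoves G ω ≤ k :=
  ((iInf_le _ d).trans (iInf_le _ ⟨S, hS⟩)).trans (by exact_mod_cast hk)

theorem le_minMoves {G : SimpleGraph V} {ω : V → C} {k : ℕ}
    (h : ∀ (d : C) (S : List (V × C)), (∀ v, play G ω S v = d) → k ≤ S.length) :
    (k : ℕ∞) ≤ minMoves G ω :=
  le_iInf fun d => le_iInf fun S => by exact_mod_cast h d S.1 S.2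

/-- A most frequent colour can be spread over the whole graph in
`|V| - ⌈|V| / c⌉` moves. -/
theorem minMoves_le [Fintype V] (G : SimpleGraph V) {c : ℕ} (hc : 1 ≤ c) (ω : V → Fin c) :
    minMoves G ω ≤ ((Fintype.card V - ⌈(Fintype.card V : ℚ) / (c : ℚ)⌉₊ : ℕ) : ℕ∞) := by
  classical
  have hc0 : (0 : ℚ) < c := by exact_mod_cast hc
  have : Nonempty (Fin c) := ⟨⟨0, hc⟩⟩
  obtain ⟨d, hd⟩ := Fintype.exists_le_card_fiber_of_nsmul_le_card (M := ℚ) ω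
    (b := (Fintype.card V : ℚ) / c) (by
      rw [nsmul_eq_mul, Fintype.card_fin, mul_div_cancel₀ _ hc0.ne'])
  have hd' := Nat.ceil_le.2 hd
  have hsum := Finset.card_filter_add_card_filter_not (s := (Finset.univ : Finset V))
    (fun v => ω v = d)
  rw [Finset.card_univ] at hsum
  obtain ⟨S, hS, hS'⟩ := exists_play_le_card_ne G d _ ω
    (show _ ≤ Fintype.card V - ⌈(Fintype.card V : ℚ) / (c : ℚ)⌉₊ by
      simp only [ne_eq]; omega)
  exact minMoves_le_of_play hS' hS

/-! ### Noncrossing partitions from winning plays. -/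

/-- The labelling `p` is noncrossing with respect to the positions `f`. -/
def Noncrossing (f p : V → ℕ) : Prop :=
  ∀ a b c d, f a < f b → f b < f c → f c < f d → p a = p c → p b = p d → p a = p b

/-- Adjacent vertices have consecutive positions on the cycle of length `n`. -/
def CyclicPositions (G : SimpleGraph V) (f : V → ℕ) (n : ℕ) : Prop :=
  (∀ v, f v < n) ∧ ∀ x y, G.Adj x y →
    f x = f y + 1 ∨ f y = f x + 1 ∨ (f x = 0 ∧ f y + 1 = n) ∨ (f y = 0 ∧ f x + 1 = n)

/-- Two vertices of a component of a subgraph of a cycle are not separated by two vertices outside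
of the component. -/
theorem CyclicPositions.between_iff {G H : SimpleGraph V} {f : V → ℕ} {n : ℕ}
    (hf : CyclicPositions G f n) (hinj : Function.Injective f) (hH : H ≤ G) {v b d x y : V}
    (hbd : f b < f d) (hb : ¬ H.Reachable v b) (hd : ¬ H.Reachable v d)
    (hx : H.Reachable v x) (hy : H.Reachable v y) :
    (f b < f x ∧ f x < f d) ↔ (f b < f y ∧ f y < f d) := by
  have key : ∀ w, H.Reachable v w →
      ((f b < f v ∧ f v < f d) ↔ (f b < f w ∧ f w < f d)) := by
    intro w hw
    refine iff_of_reachable (fun w => f b < f w ∧ f w < f d) (fun s t hs ht hst => ?_) hw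
    have h1 : f s ≠ f b := fun h => hb (hinj h ▸ hs)
    have h2 : f s ≠ f d := fun h => hd (hinj h ▸ hs)
    have h3 : f t ≠ f b := fun h => hb (hinj h ▸ ht)
    have h4 : f t ≠ f d := fun h => hd (hinj h ▸ ht)
    -- A step between consecutive positions cannot jump over `f b` or `f d`; the wrap-around edge
    -- joins `0` and `n - 1`, both outside the open interval.
    have h5 := hf.2 s t (hH hst)
    have h6 := hf.1 b
    have h7 := hf.1 d
    omega
  exact (key x hx).symm.trans (key y hy)

/-- A winning sequence of `k` moves on a cycle yields a noncrossing partition of the vertices into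
at most `k + 1` monochromatic blocks. -/
theorem exists_noncrossing_of_play {G : SimpleGraph V} {f : V → ℕ} {n : ℕ}
    (hf : CyclicPositions G f n) (hinj : Function.Injective f) (d : C) (S : List (V × C)) :
    ∀ ω : V → C, (∀ v, play G ω S v = d) →
      ∃ p : V → ℕ, (∀ v, p v ≤ S.length) ∧ Noncrossing f p ∧ ∀ x y, p x = p y → ω x = ω y := by
  classical
  induction S with
  | nil =>
    intro ω h
    exact ⟨fun _ => 0, fun _ => le_rfl, fun _ _ _ _ _ _ _ _ _ => rfl,
      fun x y _ => (h x).trans (h y).symm⟩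
  | cons m S ih =>
    intro ω h
    obtain ⟨p, hp, hnc, hω⟩ := ih (move G ω m) h
    let R : V → Prop := (monoGraph G ω).Reachable m.1
    have hle : monoGraph G ω ≤ G := fun _ _ hxy => hxy.1
    have hsep : ∀ b e x y, f b < f e → ¬ R b → ¬ R e → R x → R y →
        ((f b < f x ∧ f x < f e) ↔ (f b < f y ∧ f y < f e)) :=
      fun b e x y hbe hb he hx hy => hf.between_iff hinj hle hbe hb he hx hy
    -- The component hit by the first move is cut out of its old blocks and given a label that `p`
    -- never takes.
    let q : V → ℕ := fun v => if R v then S.length + 1 else p v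
    have hq1 : ∀ v, R v → q v = S.length + 1 := fun v hv => if_pos hv
    have hq0 : ∀ v, ¬ R v → q v = p v := fun v hv => if_neg hv
    have hiff : ∀ x y, q x = q y → (R x ↔ R y) := by
      intro x y hxy
      have h1 := hp x
      have h2 := hp y
      by_cases hx : R x <;> by_cases hy : R y <;> simp only [hx, hy]
      · rw [hq1 x hx, hq0 y hy] at hxy; omega
      · rw [hq0 x hx, hq1 y hy] at hxy; omega
    refine ⟨q, fun v => ?_, ?_, ?_⟩
    · by_cases hv : R v
      · simp [hq1 v hv]
      · rw [hq0 v hv, List.length_cons]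
        exact (hp v).trans (Nat.le_succ _)
    · intro a b e g hab hbe heg hae hbg
      have i1 := hiff a e hae
      have i2 := hiff b g hbg
      by_cases ha : R a <;> by_cases hb : R b
      · rw [hq1 a ha, hq1 b hb]
      · have := hsep b g a e (hbe.trans heg) hb (fun h => hb (i2.2 h)) ha (i1.1 ha)
        omega
      · have := hsep a e b g (hab.trans hbe) ha (fun h => ha (i1.2 h)) hb (i2.1 hb)
        omega
      · rw [hq0 a ha, hq0 e (fun h => ha (i1.2 h))] at hae
        rw [hq0 b hb, hq0 g (fun h => hb (i2.2 h))] at hbg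
        rw [hq0 a ha, hq0 b hb]
        exact hnc a b e g hab hbe heg hae hbg
    · intro x y hxy
      have i := hiff x y hxy
      by_cases hx : R x
      · exact (color_eq_of_reachable hx).trans (color_eq_of_reachable (i.1 hx)).symm
      · have hy : ¬ R y := fun h => hx (i.2 h)
        rw [hq0 x hx, hq0 y hy] at hxy
        have := hω x y hxy
        rwa [move_of_not_reachable hx, move_of_not_reachable hy] at this

end General

/-! ### Counting the blocks. -/

/-- A noncrossing partition of an interval of length `L ≥ 1` whose blocks consist of numbers
congruent modulo `c` has at least `L - (L - 1) / c` blocks. -/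
theorem card_image_noncrossing {c N : ℕ} {p : ℕ → ℕ}
    (hnc : ∀ a b e g, a < b → b < e → e < g → g < N → p a = p e → p b = p g → p a = p b)
    (hmod : ∀ x y, x < N → y < N → p x = p y → x % c = y % c) (L : ℕ) :
    ∀ s, 1 ≤ L → s + L ≤ N →
      c * L + 1 ≤ L + c * ((Finset.Ico s (s + L)).image p).card := by
  induction L using Nat.strong_induction_on with
  | _ L ih =>
    intro s hL hN
    by_cases hrep : ∃ t, s < t ∧ t < s + L ∧ p t = p s
    -- With `t` the next element of the block of `s`, no block meets both `(s, t)` and `[t, s + L)`,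
    -- so the two counts add up.
    · obtain ⟨t, ⟨hst, htL, hpt⟩, hmin⟩ : ∃ t, (s < t ∧ t < s + L ∧ p t = p s) ∧
          ∀ u, s < u → u < t → p u ≠ p s := by
        classical
        refine ⟨Nat.find hrep, Nat.find_spec hrep, fun u hu hut hpu => ?_⟩
        exact Nat.find_min hrep hut ⟨hu, hut.trans (Nat.find_spec hrep).2.1, hpu⟩
      obtain ⟨k, hk⟩ : c ∣ t - s :=
        (Nat.modEq_iff_dvd' hst.le).1 (hmod s t (by omega) (by omega) hpt.symm)
      have hk1 : 1 ≤ k := by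
        rcases Nat.eq_zero_or_pos k with h | h
        · subst h; omega
        · exact h
      have hdisj : Disjoint ((Finset.Ico (s + 1) t).image p)
          ((Finset.Ico t (s + L)).image p) := by
        rw [Finset.disjoint_left]
        intro z hz hz'
        obtain ⟨x, hx, rfl⟩ := Finset.mem_image.1 hz
        obtain ⟨y, hy, hxy⟩ := Finset.mem_image.1 hz'
        rw [Finset.mem_Ico] at hx hy
        rcases hy.1.eq_or_lt with h | h
        · exact hmin x (by omega) hx.2 (by rw [← hxy, ← h, hpt])
        · exact hmin x (by omega) hx.2
            (hnc s x t y (by omega) hx.2 h (by omega) hpt.symm hxy.symm).symm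
      have hcard : ((Finset.Ico (s + 1) t).image p).card + ((Finset.Ico t (s + L)).image p).card
          ≤ ((Finset.Ico s (s + L)).image p).card := by
        rw [← Finset.card_union_of_disjoint hdisj, ← Finset.image_union]
        refine Finset.card_le_card (Finset.image_subset_image fun x hx => ?_)
        simp only [Finset.mem_union, Finset.mem_Ico] at hx ⊢
        omega
      have hout := ih (s + L - t) (by omega) t (by omega) (by omega)
      rw [show t + (s + L - t) = s + L by omega] at hout
      -- The gap has `c * k - 1` points; integrality sharpens the inductive bound to `c * k - k`
      -- blocks. An empty gap forces `c = k = 1`.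
      have hin : c * k ≤ k + ((Finset.Ico (s + 1) t).image p).card := by
        rcases Nat.lt_or_ge 1 (t - s) with h | h
        · have hi := ih (t - s - 1) (by omega) (s + 1) (by omega) (by omega)
          rw [show s + 1 + (t - s - 1) = t by omega] at hi
          rw [hk] at hi
          obtain ⟨m, hm⟩ : ∃ m, c * k = m + 1 := ⟨c * k - 1, by omega⟩
          rw [hm, Nat.add_sub_cancel] at hi
          by_contra hlt
          push Not at hlt
          have := Nat.mul_le_mul_left c (show k + ((Finset.Ico (s + 1) t).image p).card ≤ m by omega)
          rw [mul_add] at this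
          omega
        · have : c * k = 1 := by omega
          omega
      have e1 : c * (s + L - t) + c * (c * k) = c * L := by
        rw [← mul_add]; congr 1; omega
      have e2 : s + L - t + c * k = L := by omega
      have hin' := Nat.mul_le_mul_left c hin
      have hcard' := Nat.mul_le_mul_left c hcard
      rw [mul_add] at hin' hcard'
      omega
    -- Here `s` is alone in its block, which adds one to the count for the rest.
    · push Not at hrep
      have hIco : Finset.Ico s (s + L) = insert s (Finset.Ico (s + 1) (s + L)) := by
        ext x; simp only [Finset.mem_insert, Finset.mem_Ico]; omega
      have hnot : p s ∉ (Finset.Ico (s + 1) (s + L)).image p := by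
        intro h
        obtain ⟨x, hx, hxs⟩ := Finset.mem_image.1 h
        rw [Finset.mem_Ico] at hx
        exact hrep x (by omega) hx.2 hxs
      rw [hIco, Finset.image_insert, Finset.card_insert_of_notMem hnot, mul_add]
      rcases hL.eq_or_lt with h | h
      · subst h; omega
      · have hi := ih (L - 1) (by omega) (s + 1) (by omega) (by omega)
        rw [show s + 1 + (L - 1) = s + L by omega] at hi
        have : c * (L - 1) + c = c * L := by
          rw [← mul_add_one]; congr 1; omega
        omega

/-! ### The periodic colouring of the cycle. -/

theorem cyclicPositions_of_iso {V : Type*} {G : SimpleGraph V} {n : ℕ}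
    (e : G ≃g SimpleGraph.cycleGraph n) : CyclicPositions G (fun v => (e v : ℕ)) n := by
  refine ⟨fun v => (e v).2, fun x y hxy => ?_⟩
  have h := e.map_adj_iff.2 hxy
  change (e x : ℕ) = e y + 1 ∨ (e y : ℕ) = e x + 1 ∨ ((e x : ℕ) = 0 ∧ (e y : ℕ) + 1 = n) ∨
    ((e y : ℕ) = 0 ∧ (e x : ℕ) + 1 = n)
  have hx := (e x).2
  have hy := (e y).2
  rw [SimpleGraph.cycleGraph_adj', Fin.val_sub, Fin.val_sub] at h
  rcases h with h | h
  · rcases Nat.lt_or_ge (n - (e y : ℕ) + e x) n with h' | h'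
    · rw [Nat.mod_eq_of_lt h'] at h
      omega
    · rw [Nat.mod_eq_sub_mod h', Nat.mod_eq_of_lt (by omega)] at h
      omega
  · rcases Nat.lt_or_ge (n - (e x : ℕ) + e y) n with h' | h'
    · rw [Nat.mod_eq_of_lt h'] at h
      omega
    · rw [Nat.mod_eq_sub_mod h', Nat.mod_eq_of_lt (by omega)] at h
      omega

/-- On a cycle of length `n`, the colouring with period `c` needs at least `n - ⌈n / c⌉` moves. -/
theorem le_length_of_play_periodic {V : Type*} {G : SimpleGraph V} {n c : ℕ} (hn : 1 ≤ n)
    (hc : 1 ≤ c) (e : G ≃g SimpleGraph.cycleGraph n) {ω : V → Fin c}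
    (hω : ∀ v, (ω v : ℕ) = (e v : ℕ) % c) (d : Fin c) (S : List (V × Fin c))
    (hS : ∀ v, play G ω S v = d) : n - ⌈(n : ℚ) / (c : ℚ)⌉₊ ≤ S.length := by
  obtain ⟨p, hp, hnc, hmono⟩ := exists_noncrossing_of_play (cyclicPositions_of_iso e)
    (fun x y h => e.injective (Fin.ext h)) d S ω hS
  -- The value `0` beyond `n` is never used.
  let q : ℕ → ℕ := fun i => if h : i < n then p (e.symm ⟨i, h⟩) else 0
  have hq : ∀ i (h : i < n), q i = p (e.symm ⟨i, h⟩) := fun i h => dif_pos h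
  have hcard := card_image_noncrossing (N := n) (p := q)
    (by
      intro a b x y hab hbx hxy hy h1 h2
      rw [hq a (by omega), hq x (by omega)] at h1
      rw [hq b (by omega), hq y (by omega)] at h2
      rw [hq a (by omega), hq b (by omega)]
      exact hnc _ _ _ _ (by simpa using hab) (by simpa using hbx) (by simpa using hxy) h1 h2)
    (by
      intro x y hx hy h
      rw [hq x hx, hq y hy] at h
      have := congrArg Fin.val (hmono _ _ h)
      simpa [hω] using this)
    n 0 hn (by omega)
  have hle : ((Finset.Ico 0 (0 + n)).image q).card ≤ S.length + 1 := by
    rw [← Finset.card_range (S.length + 1)]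
    refine Finset.card_le_card fun z hz => ?_
    obtain ⟨x, hx, rfl⟩ := Finset.mem_image.1 hz
    rw [Finset.mem_Ico] at hx
    rw [hq x (by omega), Finset.mem_range]
    exact Nat.lt_succ_of_le (hp _)
  have hmul := Nat.mul_le_mul_left c hle
  have hceil : n ≤ c * ⌈(n : ℚ) / (c : ℚ)⌉₊ := by
    have hc0 : (0 : ℚ) < c := by exact_mod_cast hc
    have := Nat.le_ceil ((n : ℚ) / c)
    rw [div_le_iff₀ hc0] at this
    rw [mul_comm]
    exact_mod_cast this
  by_contra hlt
  push Not at hlt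
  have := Nat.mul_le_mul_left c (show S.length + 1 + ⌈(n : ℚ) / (c : ℚ)⌉₊ ≤ n by omega)
  rw [mul_add] at this
  omega

end FloodIt

theorem mainTheorem2 {V : Type*} (G : SimpleGraph V) (n c : ℕ) (hn : 3 ≤ n)
    (hG : Nonempty (G ≃g SimpleGraph.cycleGraph n)) (hc : 1 ≤ c) (hcn : c ≤ n) :
    FloodIt.maxMoves G c = ((n - ⌈(n : ℚ) / (c : ℚ)⌉₊ : ℕ) : ℕ∞) := by
  obtain ⟨e⟩ := hG
  let : Fintype V := Fintype.ofEquiv _ e.toEquiv.symm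
  have hV : Fintype.card V = n := by rw [Fintype.card_congr e.toEquiv, Fintype.card_fin]
  apply le_antisymm
  · refine iSup_le fun ω => ?_
    have h := FloodIt.minMoves_le G hc ω.1
    rwa [hV] at h
  · let ω : V → Fin c := fun v => ⟨(e v : ℕ) % c, Nat.mod_lt _ hc⟩
    have hsurj : Function.Surjective ω := fun i =>
      ⟨e.symm ⟨i, i.2.trans_le hcn⟩, Fin.ext (by simp [ω, Nat.mod_eq_of_lt i.2])⟩
    refine le_trans (FloodIt.le_minMoves fun d S hS => ?_)
      (le_iSup (fun ω : {ω : V → Fin c // Function.Surjective ω} => FloodIt.minMoves G ω.1)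
        ⟨ω, hsurj⟩)
    exact FloodIt.le_length_of_play_periodic (by omega) hc e (fun _ => rfl) d S hS
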